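/- Let $K$ be a field with $\mathrm{char}(K)\neq 2$, let $\overline K$ be an algebraic closure of $K$, and let $f\in K[x]$ be a monic polynomial of degree $2g+1$, $g\ge 0$, without multiple roots in $\overline K$. Let $\mathcal C$ be the smooth projective curve over $\overline K$ with affine equation $y^2=f(x)$ (hyperelliptic of genus $g$, elliptic for $g=1$), with point at infinity $O$, and let $\iota:(x,y)\mapsto(x,-y)$ be its hyperelliptic involution. Put $\overline K[\mathcal C]=\overline K[x,y]/\langle y^2-f\rangle$, write $[h]$ for the class of $h\in\overline K[x,y]$, and let $\mathrm{ord}_P$ be the order function of the local ring of $\mathcal C$ at $P$. A divisor $\mathfrak d=\sum_P m_PP$ is called semi-reduced if it is effective, $m_O=0$, $m_P=1$ whenever $m_P>0$ and $P=\iota(P)$, and $m_{\iota(P)}=0$ whenever $m_P>0$ and $P\ne\iota(P)$. The Mumford representation of a semi-reduced divisor $\mathfrak d=\sum_{i=1}^r e_iP_i$ ($e_i>0$, the $P_i=(x_i,y_i)$ distinct) is the unique pair $(u,v)$ of polynomials in $\overline K[x]$ with $u=\prod_i(x-x_i)^{e_i}$, $\deg v<\deg u$, $\mathrm{ord}_{P_i}([y-v])\ge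 e_i$ for all $i$, and $u\mid v^2-f$. For an effective divisor $\mathfrak d=\sum_P e_PP$ with $O\notin\mathrm{Supp}(\mathfrak d)$ put $$\widetilde{I(\mathfrak d)}=\{h\in\overline K[x,y] : \mathrm{ord}_P([h])\ge e_P \text{ for all } P\in\mathrm{Supp}(\mathfrak d)\}.$$ Let $\mathfrak d_1,\mathfrak d_2$ be semi-reduced divisors on $\mathcal C$ such that $\mathfrak d_1+\mathfrak d_2=\mathfrak d_3+\bar{\mathfrak d}+\iota^*\bar{\mathfrak d}$ with $\mathfrak d_3$ a non-zero semi-reduced divisor and $\bar{\mathfrak d}$ an effective divisor. Let $(u_3,v_3)$ be the Mumford representation of $\mathfrak d_3$, and let $u_o\in\overline K[x]$ be a monic polynomial with $\mathrm{div}([u_o])=\bar{\mathfrak d}+\iota^*\bar{\mathfrak d}-2(\deg\bar{\mathfrak d})\,O$. Then, for the pure lexicographic order with $y>x$, the ideal $\widetilde{I(\mathfrak d_1+\mathfrak d_2)}$ has exactly one reduced Gröbner basis, and this basis contains both $u_ou_3$ and $u_o(y-v_3)$. -/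

import Mathlib

namespace HyperellipticCurve

noncomputable section

/-! ### The affine curve `y² = f(x)`

Polynomials in `x, y` are elements of `MvPolynomial (Fin 2) k`, where the variable `0` is `y` and
the variable `1` is `x`. The lexicographic order of Mathlib on `Fin 2` makes the variable `0` the
larger one, so it is the pure lexicographic order with `y > x`. -/

section Affine

variable {k : Type*} [Field k]

/-- The variable `y`. -/
abbrev varY (k : Type*) [Field k] : MvPolynomial (Fin 2) k := MvPolynomial.X 0

/-- The variable `x`. -/
abbrev varX (k : Type*) [Field k] : MvPolynomial (Fin 2) k := MvPolynomial.X 1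

/-- A polynomial in one variable, seen as a polynomial in `x` inside `k[x, y]`. -/
def inX (u : Polynomial k) : MvPolynomial (Fin 2) k := Polynomial.aeval (varX k) u

/-- The polynomial `y² - f(x)`. -/
def equation (f : Polynomial k) : MvPolynomial (Fin 2) k := varY k ^ 2 - inX f

/-- The coordinate ring `k[x, y] / (y² - f(x))`. -/
abbrev CoordRing (f : Polynomial k) : Type _ :=
  MvPolynomial (Fin 2) k ⧸ Ideal.span {equation f}

/-- The class `[b]` of a polynomial in the coordinate ring. -/
abbrev cls (f : Polynomial k) : MvPolynomial (Fin 2) k →+* CoordRing f :=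
  Ideal.Quotient.mk (Ideal.span {equation f})

/-- The `k`-rational points of the affine curve `y² = f(x)`. -/
@[ext]
structure AffinePoint (f : Polynomial k) where
  /-- the `x`-coordinate -/
  x : k
  /-- the `y`-coordinate -/
  y : k
  on_curve : y ^ 2 = f.eval x

variable {f : Polynomial k}

theorem eval_inX (v : Fin 2 → k) (u : Polynomial k) :
    MvPolynomial.eval v (inX u) = u.eval (v 1) := by
  rw [inX, ← MvPolynomial.coe_aeval_eq_eval, RingHom.coe_coe, ← Polynomial.aeval_algHom_apply]
  simp [Polynomial.aeval_def, Polynomial.eval₂_eq_eval_map]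

/-- Evaluation of polynomial functions at a point. -/
def AffinePoint.evalHom (P : AffinePoint f) : CoordRing f →+* k :=
  Ideal.Quotient.lift (Ideal.span {equation f}) (MvPolynomial.eval ![P.y, P.x]) (by
    intro a ha
    rw [← RingHom.mem_ker]
    refine (Ideal.span_le.2 ?_) ha
    rintro _ rfl
    simp [RingHom.mem_ker, equation, eval_inX, P.on_curve])

/-- The ideal of the polynomial functions that vanish at `P`. -/
def AffinePoint.ideal (P : AffinePoint f) : Ideal (CoordRing f) := RingHom.ker P.evalHom

instance AffinePoint.ideal_isPrime (P : AffinePoint f) : P.ideal.IsPrime :=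
  RingHom.ker_isPrime P.evalHom

/-- The local ring of the curve at `P`. -/
abbrev AffinePoint.localRing (P : AffinePoint f) : Type _ := Localization.AtPrime P.ideal

/-- The order `ord_P(h)` of a polynomial function `h` at `P`: the largest `n` such that `h` lies in
the `n`-th power of the maximal ideal of the local ring at `P`, and `⊤` if there is none. -/
def AffinePoint.ord (P : AffinePoint f) (h : CoordRing f) : ℕ∞ :=
  ⨆ n ∈ {n : ℕ | algebraMap (CoordRing f) P.localRing h ∈
    IsLocalRing.maximalIdeal P.localRing ^ n}, (n : ℕ∞)

theorem AffinePoint.le_ord_iff (P : AffinePoint f) (h : CoordRing f) (n : ℕ) :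
    (n : ℕ∞) ≤ P.ord h ↔ algebraMap (CoordRing f) P.localRing h ∈
      IsLocalRing.maximalIdeal P.localRing ^ n := by
  constructor
  · intro hn
    by_contra hc
    have hlt : ∀ m ∈ {m : ℕ | algebraMap (CoordRing f) P.localRing h ∈
        IsLocalRing.maximalIdeal P.localRing ^ m}, m < n := by
      intro m hm
      by_contra hmn
      exact hc (Ideal.pow_le_pow_right (not_lt.1 hmn) hm)
    rcases n with _ | n
    · exact hc (by simp)
    · have h2 : P.ord h ≤ (n : ℕ∞) :=
        iSup₂_le fun m hm => by exact_mod_cast Nat.lt_succ_iff.1 (hlt m hm)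
      have h3 := hn.trans h2
      norm_cast at h3
      omega
  · intro hn
    exact le_iSup₂_of_le n hn le_rfl

end Affine

/-! ### The completed curve and its divisors

Here `f` is monic of degree `2g + 1`, and the curve has one point `O` at infinity. -/

section Projective

variable {k : Type*} [Field k] {f : Polynomial k}

/-- The points of the completed curve; `none` is the point at infinity `O`. -/
abbrev Point (f : Polynomial k) : Type _ := Option (AffinePoint f)

/-- The point at infinity. -/
abbrev infinity (f : Polynomial k) : Point f := none

/-- The hyperelliptic involution `(x, y) ↦ (x, -y)` on affine points. -/
def AffinePoint.neg (P : AffinePoint f) : AffinePoint f :=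
  ⟨P.x, -P.y, by rw [neg_sq]; exact P.on_curve⟩

/-- The hyperelliptic involution, which fixes `O`. -/
def iota (P : Point f) : Point f := P.map AffinePoint.neg

/-- The other affine chart. In the coordinates `s = 1/x`, `t = y/x^(g+1)`, the curve `y² = f(x)`
with `deg f = 2g + 1` becomes `t² = s · (s^(2g+1) f(1/s))`, and `O` becomes `(s, t) = (0, 0)`. -/
def chartPoly (f : Polynomial k) : Polynomial k := Polynomial.X * f.reverse

/-- The point `O` in the chart at infinity. -/
def chartOrigin (f : Polynomial k) : AffinePoint (chartPoly f) :=
  ⟨0, 0, by simp [chartPoly]⟩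

/-- The weighted degree of `b` for the weights `1` of `x` and `g + 1` of `y`. -/
def chartDegree (g : ℕ) (b : MvPolynomial (Fin 2) k) : ℕ :=
  MvPolynomial.weightedTotalDegree ![g + 1, 1] b

/-- The polynomial `s^n · b(1/s, t/s^(g+1))` in the coordinates `s, t` of the chart at infinity,
where `n = chartDegree g b`; the variable `0` is `t` and the variable `1` is `s`. -/
def toChart (g : ℕ) (b : MvPolynomial (Fin 2) k) : MvPolynomial (Fin 2) k :=
  ∑ m ∈ b.support, MvPolynomial.C (b.coeff m) * varY k ^ (m 0) *
    varX k ^ (chartDegree g b - ((g + 1) * m 0 + m 1))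

/-- The order at `P` of the polynomial function given by `b ∈ k[x, y]`. At `O` one has
`b = toChart g b / s^n` with `n = chartDegree g b`. -/
def ordAt (g : ℕ) (P : Point f) (b : MvPolynomial (Fin 2) k) : WithTop ℤ :=
  match P with
  | some Q => ENat.map (fun n : ℕ => (n : ℤ)) (Q.ord (cls f b))
  | none =>
      ENat.map (fun n : ℕ => (n : ℤ))
          ((chartOrigin f).ord (cls (chartPoly f) (toChart g b))) +
        ((-((chartDegree g b : ℤ) *
          (((chartOrigin f).ord (cls (chartPoly f) (varX k))).toNat : ℤ)) : ℤ) : WithTop ℤ)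

/-- Divisors on the completed curve. -/
abbrev Divisor (f : Polynomial k) : Type _ := Point f →₀ ℤ

/-- The degree of a divisor. -/
def Divisor.deg (D : Divisor f) : ℤ := D.sum fun _ n => n

/-- The pull-back of a divisor by the hyperelliptic involution. -/
def Divisor.iotaPullback (D : Divisor f) : Divisor f := D.mapDomain iota

/-- `D` is effective. -/
def Divisor.IsEffective (D : Divisor f) : Prop := ∀ P, 0 ≤ D P

/-- `D` is affine: its support does not contain `O`. -/
def Divisor.IsAffine (D : Divisor f) : Prop := D (infinity f) = 0

/-- `D` is semi-reduced: it is effective and affine, a fixed point of the involution has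
multiplicity at most one, and of two conjugate points at most one belongs to `D`. -/
structure Divisor.IsSemiReduced (D : Divisor f) : Prop where
  effective : D.IsEffective
  affine : D.IsAffine
  fixed : ∀ P, 0 < D P → P = iota P → D P = 1
  conj : ∀ P, 0 < D P → P ≠ iota P → D (iota P) = 0

/-- `div([b]) = D`. -/
def HasDivisor (g : ℕ) (b : MvPolynomial (Fin 2) k) (D : Divisor f) : Prop :=
  ∀ P : Point f, ordAt g P b = ((D P : ℤ) : WithTop ℤ)

/-- The ideal `I(D)` of the coordinate ring, for an effective affine divisor `D`: the polynomial
functions `h` with `ord_P(h) ≥ D P` for all `P` in the support of `D`. -/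
def Divisor.ideal (D : Divisor f) : Ideal (CoordRing f) where
  carrier := {h | ∀ P : AffinePoint f, some P ∈ D.support → ((D (some P)).toNat : ℕ∞) ≤ P.ord h}
  add_mem' := by
    intro a b ha hb P hP
    have h1 := ha P hP
    have h2 := hb P hP
    rw [AffinePoint.le_ord_iff] at h1 h2 ⊢
    rw [map_add]
    exact Ideal.add_mem _ h1 h2
  zero_mem' := by
    intro P _
    rw [AffinePoint.le_ord_iff, map_zero]
    exact Ideal.zero_mem _
  smul_mem' := by
    intro c a ha P hP
    have h1 := ha P hP
    rw [AffinePoint.le_ord_iff] at h1 ⊢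
    rw [smul_eq_mul, map_mul]
    exact Ideal.mul_mem_left _ _ h1

/-- The ideal of `k[x, y]` of all `b` with `[b] ∈ I(D)`. -/
def Divisor.polyIdeal (D : Divisor f) : Ideal (MvPolynomial (Fin 2) k) :=
  D.ideal.comap (cls f)

/-- The polynomial `∏ (x - x_P)^(D P)` over the affine points of the support of `D`. -/
def Divisor.xPoly (D : Divisor f) : Polynomial k :=
  D.prod fun P n => match P with
    | some Q => (Polynomial.X - Polynomial.C Q.x) ^ n.toNat
    | none => 1

/-- `(u, v)` is the Mumford representation of the semi-reduced divisor `D`. -/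
structure Divisor.IsMumfordRep (D : Divisor f) (u v : Polynomial k) : Prop where
  u_eq : u = D.xPoly
  degree_lt : v.degree < u.degree
  ord_le : ∀ P : AffinePoint f, some P ∈ D.support →
    ((D (some P)).toNat : ℕ∞) ≤ P.ord (cls f (varY k - inX v))
  dvd : u ∣ v ^ 2 - f

end Projective

/-! ### Reduced Gröbner bases -/

section Groebner

variable {σ k : Type*} [Field k]

/-- `G` is a Gröbner basis of the ideal `I` for the monomial order `m`. -/
def IsGroebnerBasis (m : MonomialOrder σ) (I : Ideal (MvPolynomial σ k))
    (G : Finset (MvPolynomial σ k)) : Prop :=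
  (∀ p ∈ G, p ∈ I) ∧
    Ideal.span (m.leadingTerm '' (G : Set (MvPolynomial σ k))) =
      Ideal.span (m.leadingTerm '' (I : Set (MvPolynomial σ k)))

/-- `G` is a reduced Gröbner basis of `I`: its elements have leading coefficient one, and no
monomial of `p ∈ G` lies in the ideal generated by the leading terms of the other elements. -/
structure IsReducedGroebnerBasis (m : MonomialOrder σ) (I : Ideal (MvPolynomial σ k))
    (G : Finset (MvPolynomial σ k)) : Prop where
  isGroebnerBasis : IsGroebnerBasis m I G
  monic : ∀ p ∈ G, m.leadingCoeff p = 1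
  reduced : ∀ p ∈ G, ∀ a ∈ p.support, MvPolynomial.monomial a (1 : k) ∉
    Ideal.span (m.leadingTerm '' ((G : Set (MvPolynomial σ k)) \ {p}))

end Groebner

end

end HyperellipticCurve

/-! Write `F` for the curve polynomial over the algebraically closed field. Its coordinate ring is
free over `k[x]` with basis `1, y`, so every function is uniquely `A + B y`, and divisibility by a
polynomial in `x` is read off coefficientwise.

Since each point ideal is maximal, `ord_P h ≥ n` means that `h` lies in the `n`-th power of the
ideal of `P`; powers at distinct points are coprime, so the ideal of an effective affine divisor is
a product of such powers. The geometric input is `AffinePoint.ideal_mul_ideal_neg`: when `2 ≠ 0` and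
`F` has simple roots, the ideals of `P` and of its conjugate multiply to `(x - x_P)`. Hence a
divisor `D + ι^* D` has a principal ideal generated by a monic polynomial in `x`, which
`eq_of_hasDivisor` identifies with `u_o`. This gives `I(d₁ + d₂) = u_o · I(d₃)`, and
semi-reducedness gives `I(d₃) = (u₃, y - v₃)`.

An element of the lifted ideal is therefore `q (y² - F) + (A + B y)` with `A + B y = u_o (c u₃ + d
(y - v₃))`. Its leading monomial is divisible by `y²` if `q ≠ 0`, by `y x^(deg u_o)` if `q = 0` and
`d ≠ 0`, and by `x^(deg u_o u₃)` otherwise. So `u_o u₃`, `u_o (y - v₃)` and `y² - (F mod u_o u₃)`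
form a reduced Gröbner basis, the last being dropped when `u_o = 1`. Uniqueness of reduced bases
(`IsReducedGroebnerBasis.subset`) finishes the proof. -/

namespace HyperellipticCurve

noncomputable section

/-! ### Normal forms `A + B y` and lexicographic degrees -/

section NormalForm

variable {k : Type*} [Field k]

open MvPolynomial
open scoped MonomialOrder

theorem coeff_inX (u : Polynomial k) (a : Fin 2 →₀ ℕ) :
    (inX u).coeff a = if a 0 = 0 then u.coeff (a 1) else 0 := by
  classical
  induction u using Polynomial.induction_on' with
  | add p q hp hq =>
    rw [inX, map_add, coeff_add]
    change coeff a (inX p) + coeff a (inX q) = _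
    rw [hp, hq]
    split_ifs <;> simp
  | monomial n c =>
    rw [inX, Polynomial.aeval_monomial, algebraMap_eq, coeff_C_mul, coeff_X_pow,
      Polynomial.coeff_monomial]
    by_cases h0 : a 0 = 0 <;> by_cases h1 : n = a 1
    · have : Finsupp.single 1 n = a := by
        ext i; fin_cases i <;> simp [h0, h1]
      rw [if_pos this]; simp [h0, h1]
    · have : Finsupp.single 1 n ≠ a := by
        rintro rfl; simp at h1
      simp [h1, this]
    · have : Finsupp.single 1 n ≠ a := by
        rintro rfl; simp at h0
      simp [h0, this]
    · have : Finsupp.single 1 n ≠ a := by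
        rintro rfl; simp at h0
      simp [h0, this]

theorem coeff_inX_mul_varY (u : Polynomial k) (a : Fin 2 →₀ ℕ) :
    (inX u * varY k).coeff a = if a 0 = 1 then u.coeff (a 1) else 0 := by
  rw [coeff_mul_X', coeff_inX]
  by_cases h : a 0 = 0
  · simp [h]
  · rw [if_pos (by simpa using h)]
    simp only [Finsupp.coe_tsub, Pi.sub_apply, Finsupp.single_eq_same]
    have : a 0 - 1 = 0 ↔ a 0 = 1 := by omega
    simp [this]

theorem lex_lt_of_zero {a b : Fin 2 →₀ ℕ} (h : a 0 < b 0) :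
    a ≺[MonomialOrder.lex] b := by
  rw [MonomialOrder.lex_lt_iff, Finsupp.Lex.lt_iff]
  exact ⟨0, fun j hj => absurd hj (by simp), h⟩

theorem lex_lt_of_one {a b : Fin 2 →₀ ℕ} (h0 : a 0 = b 0) (h : a 1 < b 1) :
    a ≺[MonomialOrder.lex] b := by
  rw [MonomialOrder.lex_lt_iff, Finsupp.Lex.lt_iff]
  refine ⟨1, fun j hj => ?_, h⟩
  fin_cases j
  · exact h0
  · simp at hj

/-- The exponent vector of `y ^ i * x ^ j`. -/
def expo (i j : ℕ) : Fin 2 →₀ ℕ := Finsupp.single 0 i + Finsupp.single 1 j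

@[simp] theorem expo_zero (i j : ℕ) : expo i j 0 = i := by simp [expo]

@[simp] theorem expo_one (i j : ℕ) : expo i j 1 = j := by simp [expo]

theorem expo_le_iff {i j : ℕ} {a : Fin 2 →₀ ℕ} : expo i j ≤ a ↔ i ≤ a 0 ∧ j ≤ a 1 := by
  constructor
  · intro h
    exact ⟨by simpa using h 0, by simpa using h 1⟩
  · rintro ⟨h0, h1⟩ l
    fin_cases l
    · simpa using h0
    · simpa using h1

theorem eq_expo {i j : ℕ} {a : Fin 2 →₀ ℕ} (h0 : a 0 = i) (h1 : a 1 = j) : a = expo i j := by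
  ext l
  fin_cases l
  · simpa using h0
  · simpa using h1

/-- A polynomial has degree `d` when the coefficient at `d` is nonzero and no larger monomial
occurs. -/
theorem degree_eq_of_coeff {σ : Type*} {m : MonomialOrder σ} {p : MvPolynomial σ k}
    {d : σ →₀ ℕ} (hd : p.coeff d ≠ 0) (h : ∀ a ∈ p.support, a ≠ d → a ≺[m] d) :
    m.degree p = d := by
  apply m.toSyn.injective
  apply le_antisymm
  · rw [MonomialOrder.degree_le_iff]
    intro a ha
    by_cases had : a = d
    · rw [had]
    · exact (h a ha had).le
  · exact m.le_degree (mem_support_iff.2 hd)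

theorem degree_inX {u : Polynomial k} (hu : u ≠ 0) :
    MonomialOrder.lex.degree (inX u) = expo 0 u.natDegree := by
  refine degree_eq_of_coeff (by simpa [coeff_inX] using hu) fun a ha hne => ?_
  rw [mem_support_iff, coeff_inX] at ha
  split_ifs at ha with h0
  · refine lex_lt_of_one (by simp [h0]) ?_
    have h1 := Polynomial.le_natDegree_of_ne_zero ha
    have h2 : a 1 ≠ u.natDegree := fun h2 => hne (eq_expo h0 h2)
    simp only [expo_one]
    omega
  · exact absurd rfl ha

theorem degree_inX_add_inX_mul_varY (A : Polynomial k) {B : Polynomial k} (hB : B ≠ 0) :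
    MonomialOrder.lex.degree (inX A + inX B * varY k) = expo 1 B.natDegree := by
  refine degree_eq_of_coeff (by
    rw [coeff_add, coeff_inX, coeff_inX_mul_varY]; simpa using hB) fun a ha hne => ?_
  rw [mem_support_iff, coeff_add, coeff_inX, coeff_inX_mul_varY] at ha
  by_cases h0 : a 0 = 0
  · exact lex_lt_of_zero (by simp [h0])
  · by_cases h1 : a 0 = 1
    · rw [if_neg h0, if_pos h1, zero_add] at ha
      refine lex_lt_of_one (by simp [h1]) ?_
      have h3 := Polynomial.le_natDegree_of_ne_zero ha
      have h2 : a 1 ≠ B.natDegree := fun h2 => hne (eq_expo h1 h2)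
      simp only [expo_one]
      omega
    · simp [h0, h1] at ha

theorem coeff_varY_sq (a : Fin 2 →₀ ℕ) :
    (varY k ^ 2).coeff a = if a = expo 2 0 then 1 else 0 := by
  classical
  rw [coeff_X_pow]
  have : (Finsupp.single 0 2 : Fin 2 →₀ ℕ) = expo 2 0 := by simp [expo]
  rw [this]
  simp only [eq_comm]

theorem degree_varY_sq_sub_inX (u : Polynomial k) :
    MonomialOrder.lex.degree (varY k ^ 2 - inX u) = expo 2 0 := by
  refine degree_eq_of_coeff (by
    rw [coeff_sub, coeff_inX, coeff_varY_sq]; simp) fun a ha hne => ?_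
  rw [mem_support_iff, coeff_sub, coeff_inX, coeff_varY_sq, if_neg hne] at ha
  apply lex_lt_of_zero
  by_contra hc
  simp only [expo_zero] at hc
  rw [if_neg (by omega)] at ha
  simp at ha

theorem varY_sq_sub_inX_ne_zero (u : Polynomial k) : varY k ^ 2 - inX u ≠ 0 := by
  intro h
  have := degree_varY_sq_sub_inX u
  rw [h, MonomialOrder.degree_zero] at this
  simpa using DFunLike.congr_fun this 0

theorem inX_add_inX_mul_varY_eq_zero {A B : Polynomial k}
    (h : inX A + inX B * varY k = 0) : A = 0 ∧ B = 0 := by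
  have h0 : ∀ a, coeff a (inX A + inX B * varY k) = 0 := by simp [h]
  constructor <;> ext n
  · simpa [coeff_inX, coeff_inX_mul_varY] using h0 (expo 0 n)
  · simpa [coeff_inX, coeff_inX_mul_varY] using h0 (expo 1 n)

theorem degree_zero_inX_add_inX_mul_varY_le (A B : Polynomial k) :
    MonomialOrder.lex.degree (inX A + inX B * varY k) 0 ≤ 1 := by
  by_cases hB : B = 0
  · subst hB
    by_cases hA : A = 0
    · simp [hA, inX]
    · have : inX (0 : Polynomial k) = 0 := by simp [inX]
      rw [this, zero_mul, add_zero, degree_inX hA]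
      simp
  · rw [degree_inX_add_inX_mul_varY A hB]
    simp

/-- The leading monomial of `q (y² - F)` is a multiple of `y²`, which a remainder of degree at most
one in `y` cannot cancel. This yields both the uniqueness of normal forms and the case split on
leading monomials of the ideal. -/
theorem two_le_degree_mul_equation_add (F A B : Polynomial k) {q : MvPolynomial (Fin 2) k}
    (hq : q ≠ 0) :
    2 ≤ MonomialOrder.lex.degree (q * equation F + (inX A + inX B * varY k)) 0 := by
  have h1 : MonomialOrder.lex.degree (q * equation F) =
      MonomialOrder.lex.degree q + expo 2 0 := by
    rw [equation, MonomialOrder.degree_mul hq (varY_sq_sub_inX_ne_zero F),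
      degree_varY_sq_sub_inX]
  rw [MonomialOrder.degree_add_of_lt, h1]
  · simp
  · apply lex_lt_of_zero
    have := degree_zero_inX_add_inX_mul_varY_le A B
    rw [h1]
    simp only [Finsupp.coe_add, Pi.add_apply, expo_zero]
    omega

theorem exists_normal_form (F : Polynomial k) (b : MvPolynomial (Fin 2) k) :
    ∃ (q : MvPolynomial (Fin 2) k) (A B : Polynomial k),
      b = q * equation F + (inX A + inX B * varY k) := by
  induction b using MvPolynomial.induction_on with
  | C c => exact ⟨0, Polynomial.C c, 0, by simp [inX, algebraMap_eq]⟩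
  | add p r hp hr =>
    obtain ⟨q, A, B, rfl⟩ := hp
    obtain ⟨q', A', B', rfl⟩ := hr
    exact ⟨q + q', A + A', B + B', by simp only [inX, map_add]; ring⟩
  | mul_X p i hp =>
    obtain ⟨q, A, B, rfl⟩ := hp
    fin_cases i
    · refine ⟨q * varY k + inX B, B * F, A, ?_⟩
      simp only [inX, map_mul, equation, Fin.zero_eta]
      ring
    · refine ⟨q * varX k, A * Polynomial.X, B * Polynomial.X, ?_⟩
      simp only [inX, map_mul, equation, Polynomial.aeval_X, Fin.mk_one]
      ring

/-- A polynomial in `x`, as a function on the curve. -/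
def xHom (F : Polynomial k) : Polynomial k →+* CoordRing F :=
  (cls F).comp (Polynomial.aeval (varX k)).toRingHom

theorem xHom_apply (F u : Polynomial k) : xHom F u = cls F (inX u) := rfl

/-- The function `y` on the curve. -/
def yFun (F : Polynomial k) : CoordRing F := cls F (varY k)

theorem yFun_sq (F : Polynomial k) : yFun F ^ 2 = xHom F F := by
  rw [yFun, xHom_apply, ← map_pow, ← sub_eq_zero, ← map_sub]
  exact Ideal.Quotient.eq_zero_iff_mem.2 (Ideal.subset_span rfl)

theorem exists_xHom_add (F : Polynomial k) (h : CoordRing F) :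
    ∃ A B : Polynomial k, h = xHom F A + xHom F B * yFun F := by
  obtain ⟨b, rfl⟩ := Ideal.Quotient.mk_surjective h
  obtain ⟨q, A, B, rfl⟩ := exists_normal_form F b
  refine ⟨A, B, ?_⟩
  have h0 : cls F (equation F) = 0 :=
    Ideal.Quotient.eq_zero_iff_mem.2 (Ideal.subset_span rfl)
  change cls F _ = _
  rw [map_add, map_mul, h0, mul_zero, zero_add, map_add, map_mul]
  rfl

theorem xHom_add_eq_zero {F A B : Polynomial k} (h : xHom F A + xHom F B * yFun F = 0) :
    A = 0 ∧ B = 0 := by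
  have h1 : cls F (inX A + inX B * varY k) = 0 := by
    rw [map_add, map_mul]; exact h
  rw [Ideal.Quotient.eq_zero_iff_mem, Ideal.mem_span_singleton'] at h1
  obtain ⟨q, hq⟩ := h1
  apply inX_add_inX_mul_varY_eq_zero
  by_cases hq0 : q = 0
  · rw [← hq, hq0, zero_mul]
  · have h2 := two_le_degree_mul_equation_add F 0 0 hq0
    have h3 := degree_zero_inX_add_inX_mul_varY_le A B
    rw [show inX (0 : Polynomial k) = 0 by simp [inX], zero_mul, add_zero, add_zero, hq] at h2
    omega

theorem xHom_add_inj {F A B A' B' : Polynomial k}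
    (h : xHom F A + xHom F B * yFun F = xHom F A' + xHom F B' * yFun F) :
    A = A' ∧ B = B' := by
  have := xHom_add_eq_zero (F := F) (A := A - A') (B := B - B') (by
    rw [map_sub, map_sub]; linear_combination h)
  exact ⟨sub_eq_zero.1 this.1, sub_eq_zero.1 this.2⟩

theorem xHom_dvd_iff {F w A B : Polynomial k} :
    xHom F w ∣ xHom F A + xHom F B * yFun F ↔ w ∣ A ∧ w ∣ B := by
  constructor
  · rintro ⟨h, hh⟩
    obtain ⟨C, D, rfl⟩ := exists_xHom_add F h
    have := xHom_add_inj (F := F) (A' := w * C) (B' := w * D) (by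
      rw [hh, map_mul, map_mul]; ring)
    exact ⟨⟨C, this.1⟩, ⟨D, this.2⟩⟩
  · rintro ⟨h1, h2⟩
    exact dvd_add ((xHom F).map_dvd h1) (((xHom F).map_dvd h2).mul_right _)

theorem xHom_dvd_xHom {F w A : Polynomial k} : xHom F w ∣ xHom F A ↔ w ∣ A := by
  have := xHom_dvd_iff (F := F) (w := w) (A := A) (B := 0)
  simpa using this

end NormalForm

/-! ### Ideals of points, their powers and conjugates -/

section PointIdeals

variable {k : Type*} [Field k] {F : Polynomial k}

open Polynomial

namespace AffinePoint

theorem evalHom_xHom (P : AffinePoint F) (u : k[X]) : P.evalHom (xHom F u) = u.eval P.x := by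
  rw [xHom_apply, evalHom, Ideal.Quotient.lift_mk, eval_inX]
  simp

theorem evalHom_yFun (P : AffinePoint F) : P.evalHom (yFun F) = P.y := by
  rw [yFun, evalHom, Ideal.Quotient.lift_mk]
  simp

theorem mem_ideal (P : AffinePoint F) (h : CoordRing F) : h ∈ P.ideal ↔ P.evalHom h = 0 :=
  RingHom.mem_ker

instance ideal_isMaximal (P : AffinePoint F) : P.ideal.IsMaximal :=
  RingHom.ker_isMaximal_of_surjective P.evalHom fun c => ⟨xHom F (C c), by simp [evalHom_xHom]⟩

/-- An element outside a maximal ideal is a unit modulo each of its powers, so these powers are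
contracted from the localization. Orders can thus be handled in the coordinate ring itself. -/
theorem le_ord_iff_mem_pow (P : AffinePoint F) (h : CoordRing F) (n : ℕ) :
    (n : ℕ∞) ≤ P.ord h ↔ h ∈ P.ideal ^ n := by
  rw [le_ord_iff, ← Localization.AtPrime.map_eq_maximalIdeal, ← Ideal.map_pow]
  refine ⟨fun hm => ?_, fun hm => Ideal.mem_map_of_mem _ hm⟩
  rw [IsLocalization.algebraMap_mem_map_algebraMap_iff P.ideal.primeCompl] at hm
  obtain ⟨s, hs, hsh⟩ := hm
  have htop : P.ideal ⊔ Ideal.span {s} = ⊤ := by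
    refine P.ideal_isMaximal.out.2 _ (lt_of_le_of_ne le_sup_left fun he => hs ?_)
    rw [he]
    exact Ideal.mem_sup_right (Ideal.mem_span_singleton_self s)
  have htop' : P.ideal ^ n ⊔ Ideal.span {s} = ⊤ := Ideal.pow_sup_eq_top htop
  have h1 : (1 : CoordRing F) ∈ P.ideal ^ n ⊔ Ideal.span {s} := htop' ▸ Submodule.mem_top
  obtain ⟨a, ha, t, ht, hat⟩ := Submodule.mem_sup.1 h1
  obtain ⟨c, rfl⟩ := Ideal.mem_span_singleton'.1 ht
  have : h = h * a + c * (s * h) := by linear_combination (-h) * hat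
  rw [this]
  exact Ideal.add_mem _ (Ideal.mul_mem_left _ _ ha) (Ideal.mul_mem_left _ _ hsh)

theorem ideal_eq_span (P : AffinePoint F) :
    P.ideal = Ideal.span {xHom F (X - C P.x), yFun F - xHom F (C P.y)} := by
  apply le_antisymm
  · intro h hh
    obtain ⟨A, B, rfl⟩ := exists_xHom_add F h
    rw [mem_ideal, map_add, map_mul, evalHom_xHom, evalHom_xHom, evalHom_yFun] at hh
    obtain ⟨D, hD⟩ : X - C P.x ∣ A + B * C P.y := by
      rw [dvd_iff_isRoot]; simpa using hh
    refine Ideal.mem_span_pair.2 ⟨xHom F D, xHom F B, ?_⟩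
    have h1 := congrArg (xHom F) hD
    rw [map_add, map_mul, map_mul] at h1
    linear_combination -h1
  · rw [Ideal.span_le]
    rintro h (rfl | rfl)
    · simp [mem_ideal, evalHom_xHom]
    · simp [mem_ideal, evalHom_xHom, evalHom_yFun]

@[simp] theorem neg_x (P : AffinePoint F) : P.neg.x = P.x := rfl

@[simp] theorem neg_y (P : AffinePoint F) : P.neg.y = -P.y := rfl

@[simp] theorem neg_neg (P : AffinePoint F) : P.neg.neg = P := by
  ext <;> simp

/-- The only product of generators without a visible factor `x - x_P` is `(y - y_P)(y + y_P) = F -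
y_P²`, which vanishes at `x_P`. -/
theorem ideal_mul_ideal_neg_le (P : AffinePoint F) :
    P.ideal * P.neg.ideal ≤ Ideal.span {xHom F (X - C P.x)} := by
  rw [P.ideal_eq_span, P.neg.ideal_eq_span, Ideal.span_mul_span, Ideal.span_le]
  intro h hh
  simp only [neg_x, neg_y] at hh
  obtain ⟨i, hi, j, hj, rfl⟩ := hh
  rw [SetLike.mem_coe, Ideal.mem_span_singleton]
  rcases hi with rfl | rfl
  · exact dvd_mul_right _ _
  rcases hj with rfl | rfl
  · exact dvd_mul_left _ _
  have : (yFun F - xHom F (C P.y)) * (yFun F - xHom F (C (-P.y))) =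
      xHom F (F - C (P.y ^ 2)) := by
    simp only [map_neg, map_sub, map_pow]
    linear_combination yFun_sq F
  change _ ∣ (yFun F - xHom F (C P.y)) * (yFun F - xHom F (C (-P.y)))
  rw [this]
  apply _root_.map_dvd
  rw [dvd_iff_isRoot]
  simp [P.on_curve]

/-- At a branch point `F = (x - x_P) q` with `q(x_P) ≠ 0` because the root is simple, so `x - x_P`
is a combination of `F = y²` and `(x - x_P)²`. Elsewhere `(x - x_P)(y + y_P) - (y - y_P)(x - x_P) =
2 y_P (x - x_P)` with `2 y_P` invertible. -/
theorem ideal_mul_ideal_neg (h2 : (2 : k) ≠ 0) (hF : F ≠ 0) (hroots : F.roots.Nodup)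
    (P : AffinePoint F) :
    P.ideal * P.neg.ideal = Ideal.span {xHom F (X - C P.x)} := by
  classical
  refine le_antisymm P.ideal_mul_ideal_neg_le ?_
  rw [Ideal.span_singleton_le_iff_mem]
  have hx : xHom F (X - C P.x) ∈ P.ideal := by simp [mem_ideal, evalHom_xHom]
  have hx' : xHom F (X - C P.x) ∈ P.neg.ideal := by simp [mem_ideal, evalHom_xHom]
  have hy : yFun F - xHom F (C P.y) ∈ P.ideal := by simp [mem_ideal, evalHom_xHom, evalHom_yFun]
  have hy' : yFun F + xHom F (C P.y) ∈ P.neg.ideal := by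
    simp [mem_ideal, evalHom_xHom, evalHom_yFun]
  by_cases hb : P.y = 0
  · obtain ⟨q, hq⟩ : X - C P.x ∣ F := by
      rw [dvd_iff_isRoot, IsRoot, ← P.on_curve, hb]; simp
    have hqa : q.eval P.x ≠ 0 := by
      intro h0
      obtain ⟨r, hr⟩ := dvd_iff_isRoot.2 h0
      have h1 : 2 ≤ F.rootMultiplicity P.x := by
        rw [le_rootMultiplicity_iff hF]
        exact ⟨r, by linear_combination hq + (X - C P.x) * hr⟩
      rw [← count_roots] at h1
      have := Multiset.nodup_iff_count_le_one.1 hroots P.x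
      omega
    obtain ⟨r, hr⟩ : X - C P.x ∣ q - C (q.eval P.x) := by
      rw [dvd_iff_isRoot]; simp
    have key : X - C P.x = C (q.eval P.x)⁻¹ * F -
        C (q.eval P.x)⁻¹ * r * ((X - C P.x) * (X - C P.x)) := by
      have h1 : C (q.eval P.x)⁻¹ * C (q.eval P.x) = (1 : k[X]) := by
        rw [← C_mul, inv_mul_cancel₀ hqa, C_1]
      linear_combination -(C (q.eval P.x)⁻¹ * (X - C P.x)) * hr - (X - C P.x) * h1 -
        C (q.eval P.x)⁻¹ * hq
    have hFy : xHom F F = (yFun F - xHom F (C P.y)) * (yFun F + xHom F (C P.y)) := by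
      rw [hb, C_0, map_zero, ← yFun_sq]; ring
    rw [key, map_sub, map_mul, map_mul, map_mul (xHom F) (X - C P.x), hFy]
    exact Ideal.sub_mem _ (Ideal.mul_mem_left _ _ (Ideal.mul_mem_mul hy hy'))
      (Ideal.mul_mem_left _ _ (Ideal.mul_mem_mul hx hx'))
  · have hc : (2 : k) * P.y ≠ 0 := mul_ne_zero h2 hb
    have h1 : xHom F (C (2 * P.y)⁻¹) * xHom F (C (2 * P.y)) = 1 := by
      rw [← map_mul, ← C_mul, inv_mul_cancel₀ hc, C_1, map_one]
    have h3 : xHom F (C (2 * P.y)) = 2 * xHom F (C P.y) := by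
      rw [C_mul, map_mul, show (C 2 : k[X]) = 2 from rfl, map_ofNat]
    have key : xHom F (X - C P.x) = xHom F (C (2 * P.y)⁻¹) *
        (xHom F (X - C P.x) * (yFun F + xHom F (C P.y)) -
          (yFun F - xHom F (C P.y)) * xHom F (X - C P.x)) := by
      rw [h3] at h1
      linear_combination -xHom F (X - C P.x) * h1
    rw [key]
    exact Ideal.mul_mem_left _ _ (Ideal.sub_mem _ (Ideal.mul_mem_mul hx hy')
      (Ideal.mul_mem_mul hy hx'))

theorem ideal_pow_mul_ideal_neg_pow_le (P : AffinePoint F) (e : ℕ) :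
    P.ideal ^ e * P.neg.ideal ^ e ≤ Ideal.span {xHom F ((X - C P.x) ^ e)} := by
  rw [map_pow, ← Ideal.span_singleton_pow]
  exact (mul_pow P.ideal P.neg.ideal e).ge.trans
    (Ideal.pow_right_mono P.ideal_mul_ideal_neg_le e)

/-- A polynomial in `x` in the `e`-th power of the ideal of a point that is not fixed by the
involution is divisible by `(x - x_P) ^ e`. -/
theorem pow_dvd_of_xHom_mem_pow (h2 : (2 : k) ≠ 0) (P : AffinePoint F) (hb : P.y ≠ 0) {e : ℕ}
    {c : k[X]} (hc : xHom F c ∈ P.ideal ^ e) : (X - C P.x) ^ e ∣ c := by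
  have hy' : yFun F + xHom F (C P.y) ∈ P.neg.ideal := by
    simp [mem_ideal, evalHom_xHom, evalHom_yFun]
  -- Multiplying `c` by `(y + y_P)^e` gives a multiple of `(x - x_P)^e`. With `(y + y_P)^e = S + T
  -- y`, the value `(2 y_P)^e` at `P` is nonzero, so `S` or `T` is prime to `x - x_P`, and that
  -- coefficient forces the divisibility of `c`.
  have h1 := P.ideal_pow_mul_ideal_neg_pow_le e
    (Ideal.mul_mem_mul hc (Ideal.pow_mem_pow hy' e))
  obtain ⟨S, T, hST⟩ := exists_xHom_add F ((yFun F + xHom F (C P.y)) ^ e)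
  have h3 : S.eval P.x + T.eval P.x * P.y ≠ 0 := by
    have := congrArg P.evalHom hST
    simp only [map_pow, map_add, map_mul, evalHom_xHom, evalHom_yFun, eval_C] at this
    rw [← this, ← two_mul]
    exact pow_ne_zero _ (mul_ne_zero h2 hb)
  have h4 : xHom F c * (xHom F S + xHom F T * yFun F) =
      xHom F (c * S) + xHom F (c * T) * yFun F := by
    simp only [map_mul]; ring
  rw [Ideal.mem_span_singleton, hST, h4, xHom_dvd_iff] at h1
  have hcop : ∀ s : k[X], s.eval P.x ≠ 0 → IsCoprime ((X - C P.x) ^ e) s := fun s hs =>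
    IsCoprime.pow_left (((irreducible_X_sub_C P.x).coprime_iff_not_dvd).2
      fun hd => hs (dvd_iff_isRoot.1 hd))
  by_cases hS : S.eval P.x = 0
  · exact (hcop T fun hT => h3 (by simp [hS, hT])).dvd_of_dvd_mul_right h1.2
  · exact (hcop S hS).dvd_of_dvd_mul_right h1.1

theorem isCoprime_ideal {P Q : AffinePoint F} (hPQ : P ≠ Q) : IsCoprime P.ideal Q.ideal := by
  rw [Ideal.isCoprime_iff_sup_eq]
  apply Ideal.IsMaximal.coprime_of_ne P.ideal_isMaximal Q.ideal_isMaximal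
  intro he
  apply hPQ
  have hx : xHom F (X - C P.x) ∈ Q.ideal := he ▸ by simp [mem_ideal, evalHom_xHom]
  have hy : yFun F - xHom F (C P.y) ∈ Q.ideal := he ▸ by
    simp [mem_ideal, evalHom_xHom, evalHom_yFun]
  ext
  · simpa [mem_ideal, evalHom_xHom, sub_eq_zero, eq_comm] using hx
  · simpa [mem_ideal, evalHom_xHom, evalHom_yFun, sub_eq_zero, eq_comm] using hy

theorem mem_prod_ideal_pow (s : Finset (AffinePoint F)) (e : AffinePoint F → ℕ)
    (h : CoordRing F) :
    h ∈ ∏ P ∈ s, P.ideal ^ e P ↔ ∀ P ∈ s, h ∈ P.ideal ^ e P := by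
  rw [Ideal.prod_eq_iInf_of_pairwise_isCoprime]
  · simp
  · intro P _ Q _ hPQ
    exact (isCoprime_ideal hPQ).pow

end AffinePoint

end PointIdeals

/-! ### Ideals of divisors: the principal part and the semi-reduced part -/

section DivisorIdeals

variable {k : Type*} [Field k] {F : Polynomial k}

open Polynomial

namespace Divisor

theorem mem_ideal_iff (D : Divisor F) (h : CoordRing F) :
    h ∈ D.ideal ↔ ∀ P : AffinePoint F, h ∈ P.ideal ^ (D (some P)).toNat := by
  change (∀ P : AffinePoint F, some P ∈ D.support → ((D (some P)).toNat : ℕ∞) ≤ P.ord h) ↔ _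
  refine forall_congr' fun P => ?_
  rw [AffinePoint.le_ord_iff_mem_pow]
  refine ⟨fun hP => ?_, fun hP _ => hP⟩
  by_cases h0 : D (some P) = 0
  · simp [h0]
  · exact hP (Finsupp.mem_support_iff.2 h0)

theorem iota_injective : Function.Injective (iota : Point F → Point F) := by
  apply Option.map_injective
  intro P Q h
  rw [← P.neg_neg, h, Q.neg_neg]

theorem iotaPullback_some (D : Divisor F) (P : AffinePoint F) :
    D.iotaPullback (some P) = D (some P.neg) := by
  have h : (some P : Point F) = iota (some P.neg) := by simp [iota]
  rw [h, iotaPullback, Finsupp.mapDomain_apply iota_injective]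

theorem toNat_add_iotaPullback {D : Divisor F} (hD : D.IsEffective) (P : AffinePoint F) :
    ((D + D.iotaPullback) (some P)).toNat = (D (some P)).toNat + (D (some P.neg)).toNat := by
  rw [Finsupp.add_apply, iotaPullback_some, Int.toNat_add (hD _) (hD _)]

/-- As `s` is stable under the involution, the factors with exponent `D (ι P)` can be reindexed,
which pairs each point ideal with its conjugate; every pair is principal. -/
theorem exists_prod_ideal_pow_eq_span (h2 : (2 : k) ≠ 0) (hF : F ≠ 0) (hroots : F.roots.Nodup)
    {D : Divisor F} (hD : D.IsEffective) {s : Finset (AffinePoint F)}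
    (hs : ∀ P ∈ s, P.neg ∈ s) :
    ∃ w : k[X], w.Monic ∧ ∏ P ∈ s, P.ideal ^ ((D + D.iotaPullback) (some P)).toNat =
      Ideal.span {xHom F w} := by
  refine ⟨∏ P ∈ s, (X - C P.x) ^ (D (some P)).toNat,
    monic_prod_of_monic _ _ fun P _ => (monic_X_sub_C _).pow _, ?_⟩
  have h1 : ∏ P ∈ s, P.ideal ^ (D (some P.neg)).toNat =
      ∏ P ∈ s, P.neg.ideal ^ (D (some P)).toNat :=
    Finset.prod_nbij' AffinePoint.neg AffinePoint.neg hs hs (by simp) (by simp) (by simp)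
  calc ∏ P ∈ s, P.ideal ^ ((D + D.iotaPullback) (some P)).toNat
      = ∏ P ∈ s, (P.ideal ^ (D (some P)).toNat * P.ideal ^ (D (some P.neg)).toNat) :=
        Finset.prod_congr rfl fun P _ => by
          rw [toNat_add_iotaPullback hD]
          exact pow_add P.ideal _ _
    _ = ∏ P ∈ s, (P.ideal * P.neg.ideal) ^ (D (some P)).toNat := by
        rw [Finset.prod_mul_distrib, h1, ← Finset.prod_mul_distrib]
        exact Finset.prod_congr rfl fun P _ => (mul_pow P.ideal P.neg.ideal _).symm
    _ = ∏ P ∈ s, Ideal.span {xHom F ((X - C P.x) ^ (D (some P)).toNat)} :=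
        Finset.prod_congr rfl fun P _ => by
          rw [P.ideal_mul_ideal_neg h2 hF hroots, Ideal.span_singleton_pow, map_pow]
    _ = _ := by rw [Ideal.prod_span_singleton, map_prod]

theorem ord_xHom_of_hasDivisor {g : ℕ} {u : k[X]} {E : Divisor F} {m : ℤ}
    (hdiv : HasDivisor g (inX u) (E - Finsupp.single (infinity F) m)) (P : AffinePoint F) :
    P.ord (xHom F u) = ((E (some P)).toNat : ℕ∞) := by
  have h := hdiv (some P)
  rw [Finsupp.sub_apply, Finsupp.single_eq_of_ne (by simp), sub_zero] at h
  change ENat.map (fun n : ℕ => (n : ℤ)) (P.ord (xHom F u)) = _ at h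
  revert h
  generalize P.ord (xHom F u) = a
  induction a using ENat.recTopCoe with
  | top => intro h; exact absurd h (by simp)
  | coe n =>
    intro h
    have h' : (n : ℤ) = E (some P) := by
      rw [ENat.map_natCast] at h
      exact_mod_cast h
    rw [← h', Int.toNat_natCast]

/-- Membership in the product gives `w ∣ u`. If the monic quotient were not `1`, it would have a
root, and at a point above that root the order of `u` would exceed the prescribed value. -/
theorem eq_of_hasDivisor [IsAlgClosed k] {g : ℕ} {u w : k[X]} {E : Divisor F} {m : ℤ}
    (hu : u.Monic) (hw : w.Monic)
    (hdiv : HasDivisor g (inX u) (E - Finsupp.single (infinity F) m))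
    {s : Finset (AffinePoint F)} (hs : ∀ P ∉ s, E (some P) = 0)
    (hprod : ∏ P ∈ s, P.ideal ^ (E (some P)).toNat = Ideal.span {xHom F w}) : u = w := by
  have hmem : ∀ P : AffinePoint F, xHom F u ∈ P.ideal ^ (E (some P)).toNat := fun P => by
    rw [← AffinePoint.le_ord_iff_mem_pow, ord_xHom_of_hasDivisor hdiv]
  have hnot : ∀ P : AffinePoint F, xHom F u ∉ P.ideal ^ ((E (some P)).toNat + 1) := fun P => by
    rw [← AffinePoint.le_ord_iff_mem_pow, ord_xHom_of_hasDivisor hdiv, Nat.cast_le]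
    omega
  have h1 : xHom F u ∈ Ideal.span {xHom F w} := by
    rw [← hprod, AffinePoint.mem_prod_ideal_pow]
    exact fun P _ => hmem P
  rw [Ideal.mem_span_singleton, xHom_dvd_xHom] at h1
  obtain ⟨q, rfl⟩ := h1
  have hq : q.Monic := hw.of_mul_monic_left hu
  by_cases hq0 : q.degree = 0
  · rw [hq.degree_le_zero_iff_eq_one.1 hq0.le, mul_one]
  · obtain ⟨a, ha⟩ := IsAlgClosed.exists_root q hq0
    obtain ⟨b, hb⟩ := IsAlgClosed.exists_pow_nat_eq (F.eval a) two_pos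
    let P : AffinePoint F := ⟨a, b, hb⟩
    refine absurd ?_ (hnot P)
    rw [map_mul]
    refine (pow_succ P.ideal _).ge (Ideal.mul_mem_mul ?_ ?_)
    · by_cases hP : P ∈ s
      · have : xHom F w ∈ ∏ P ∈ s, P.ideal ^ (E (some P)).toNat :=
          hprod ▸ Ideal.mem_span_singleton_self _
        exact (AffinePoint.mem_prod_ideal_pow _ _ _).1 this P hP
      · simp [hs P hP]
    · rw [AffinePoint.mem_ideal, AffinePoint.evalHom_xHom]
      exact ha

/-- The ideal of `D' + D + ι^* D` is the ideal of `D'` times the polynomial `u` in `x` that cuts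
out `D + ι^* D`. -/
theorem mem_ideal_add_iff [IsAlgClosed k] (h2 : (2 : k) ≠ 0) (hF : F ≠ 0)
    (hroots : F.roots.Nodup) {g : ℕ} {u : k[X]} (hu : u.Monic) {D D' : Divisor F} {m : ℤ}
    (hD : D.IsEffective) (hD' : D'.IsEffective)
    (hdiv : HasDivisor g (inX u) (D + D.iotaPullback - Finsupp.single (infinity F) m))
    (h : CoordRing F) :
    h ∈ (D' + D + D.iotaPullback).ideal ↔ ∃ h' ∈ D'.ideal, h = xHom F u * h' := by
  classical
  set E : Divisor F := D + D.iotaPullback with hE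
  have hEeff : ∀ P, 0 ≤ E (some P) := fun P => by
    rw [hE, Finsupp.add_apply, iotaPullback_some]
    exact add_nonneg (hD _) (hD _)
  -- A finite set stable under the involution and containing both affine supports lets all the
  -- ideals be written as products over the same index set.
  let t : Finset (AffinePoint F) := (D.support ∪ D'.support).eraseNone
  let s : Finset (AffinePoint F) := t ∪ t.image AffinePoint.neg
  have hs : ∀ P ∈ s, P.neg ∈ s := by
    intro P hP
    rcases Finset.mem_union.1 hP with hP | hP
    · exact Finset.mem_union_right _ (Finset.mem_image_of_mem _ hP)
    · obtain ⟨Q, hQ, rfl⟩ := Finset.mem_image.1 hP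
      rw [Q.neg_neg]
      exact Finset.mem_union_left _ hQ
  have ht : ∀ P ∉ s, D (some P) = 0 ∧ D' (some P) = 0 := by
    intro P hP
    have : P ∉ t := fun hPt => hP (Finset.mem_union_left _ hPt)
    simpa [t, Finset.mem_eraseNone] using this
  have hsE : ∀ P ∉ s, E (some P) = 0 := by
    intro P hP
    have h3 : P.neg ∉ s := fun hn => hP (by simpa using hs _ hn)
    rw [hE, Finsupp.add_apply, iotaPullback_some, (ht P hP).1, (ht _ h3).1, add_zero]
  obtain ⟨w, hw, hprod⟩ := exists_prod_ideal_pow_eq_span h2 hF hroots hD hs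
  have huw : u = w := eq_of_hasDivisor hu hw hdiv hsE hprod
  subst huw
  have hmem : ∀ (G : Divisor F), (∀ P ∉ s, G (some P) = 0) → ∀ r : CoordRing F,
      r ∈ G.ideal ↔ r ∈ ∏ P ∈ s, P.ideal ^ (G (some P)).toNat := by
    intro G hG r
    rw [mem_ideal_iff, AffinePoint.mem_prod_ideal_pow]
    refine ⟨fun hr P _ => hr P, fun hr P => ?_⟩
    by_cases hP : P ∈ s
    · exact hr P hP
    · simp [hG P hP]
  have hsplit : ∏ P ∈ s, P.ideal ^ ((D' + E) (some P)).toNat =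
      (∏ P ∈ s, P.ideal ^ (D' (some P)).toNat) * Ideal.span {xHom F u} := by
    rw [← hprod, ← Finset.prod_mul_distrib]
    refine Finset.prod_congr rfl fun P _ => ?_
    rw [Finsupp.add_apply, Int.toNat_add (hD' _) (hEeff _)]
    exact pow_add P.ideal _ _
  rw [add_assoc, hmem (D' + E) (fun P hP => by
    rw [Finsupp.add_apply, (ht P hP).2, hsE P hP, add_zero]), hsplit, Ideal.mem_mul_span_singleton]
  constructor
  · rintro ⟨z, hz, rfl⟩
    exact ⟨z, (hmem D' (fun P hP => (ht P hP).2) z).2 hz, mul_comm _ _⟩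
  · rintro ⟨z, hz, rfl⟩
    exact ⟨z, (hmem D' (fun P hP => (ht P hP).2) z).1 hz, mul_comm _ _⟩

theorem pow_dvd_xPoly (D : Divisor F) {P : AffinePoint F} (hP : some P ∈ D.support) :
    (X - C P.x) ^ (D (some P)).toNat ∣ D.xPoly := by
  have h : _ ∣ D.xPoly := Finset.dvd_prod_of_mem _ hP
  exact h

/-- Distinct points with equal `x` are conjugate, so semi-reducedness makes the factors of `xPoly`
pairwise coprime and each can be treated alone. A branch point has multiplicity one, where
evaluation suffices; the other points fall under `pow_dvd_of_xHom_mem_pow`. -/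
theorem IsSemiReduced.xPoly_dvd (h2 : (2 : k) ≠ 0) {D : Divisor F} (hD : D.IsSemiReduced)
    {c : k[X]} (hc : xHom F c ∈ D.ideal) : D.xPoly ∣ c := by
  rw [mem_ideal_iff] at hc
  refine Finset.prod_dvd_of_coprime ?_ ?_
  · rintro (_ | P) hP (_ | Q) hQ hPQ
    · exact absurd rfl hPQ
    · exact isCoprime_one_left
    · exact isCoprime_one_right
    · refine IsCoprime.pow (isCoprime_X_sub_C_of_isUnit_sub (sub_ne_zero.2 fun hx => ?_).isUnit)
      have hpos : 0 < D (some P) :=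
        lt_of_le_of_ne (hD.effective _) (Finsupp.mem_support_iff.1 hP).symm
      have hyy : Q.y = P.y ∨ Q.y = -P.y := by
        rw [← sq_eq_sq_iff_eq_or_eq_neg, P.on_curve, Q.on_curve, hx]
      have hQP : Q = P.neg := by
        rcases hyy with hy | hy
        · exact absurd (congrArg some (AffinePoint.ext hx hy.symm)) hPQ
        · exact AffinePoint.ext hx.symm hy
      subst hQP
      exact Finsupp.mem_support_iff.1 hQ (hD.conj _ hpos hPQ)
  · rintro (_ | P) hP
    · exact one_dvd _
    · change (X - C P.x) ^ (D (some P)).toNat ∣ c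
      by_cases hb : P.y = 0
      · have hpos : 0 < D (some P) :=
          lt_of_le_of_ne (hD.effective _) (Finsupp.mem_support_iff.1 hP).symm
        have h1 : D (some P) = 1 := hD.fixed _ hpos (by
          simp only [iota, Option.map_some, Option.some.injEq]
          ext <;> simp [hb])
        have h3 := hc P
        rw [h1, Int.toNat_one] at h3 ⊢
        have h4 : xHom F c ∈ P.ideal := (pow_one P.ideal).le h3
        rw [AffinePoint.mem_ideal, AffinePoint.evalHom_xHom] at h4
        rw [pow_one, dvd_iff_isRoot]
        exact h4
      · exact P.pow_dvd_of_xHom_mem_pow h2 hb (hc P)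

/-- The ideal of a semi-reduced divisor is generated by `u` and `y - v`. -/
theorem IsMumfordRep.mem_ideal_iff (h2 : (2 : k) ≠ 0) {D : Divisor F} (hD : D.IsSemiReduced)
    {u v : k[X]} (hM : D.IsMumfordRep u v) (h : CoordRing F) :
    h ∈ D.ideal ↔ ∃ c d : k[X], h = xHom F c * xHom F u + xHom F d * (yFun F - xHom F v) := by
  have hy : yFun F - xHom F v ∈ D.ideal := by
    intro P hP
    have := hM.ord_le P hP
    rwa [map_sub] at this
  constructor
  · intro hh
    obtain ⟨A, B, rfl⟩ := exists_xHom_add F h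
    -- Modulo `y - v` the function `A + B y` becomes a polynomial in `x`, which must be divisible by
    -- `u`.
    have h1 : xHom F (A + B * v) ∈ D.ideal := by
      have : xHom F (A + B * v) =
          xHom F A + xHom F B * yFun F - xHom F B * (yFun F - xHom F v) := by
        simp only [map_add, map_mul]; ring
      rw [this]
      exact Ideal.sub_mem _ hh (Ideal.mul_mem_left _ _ hy)
    obtain ⟨c, hc⟩ := hD.xPoly_dvd h2 h1
    rw [← hM.u_eq] at hc
    refine ⟨c, B, ?_⟩
    have := congrArg (xHom F) hc
    simp only [map_add, map_mul] at this
    linear_combination this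
  · rintro ⟨c, d, rfl⟩
    refine Ideal.add_mem _ (Ideal.mul_mem_left _ _ ?_) (Ideal.mul_mem_left _ _ hy)
    intro P hP
    rw [AffinePoint.le_ord_iff_mem_pow]
    have h1 := D.pow_dvd_xPoly hP
    rw [← hM.u_eq] at h1
    obtain ⟨r, hr⟩ := h1
    rw [hr, map_mul, map_pow]
    exact Ideal.mul_mem_right _ _ (Ideal.pow_mem_pow (by
      simp [AffinePoint.mem_ideal, AffinePoint.evalHom_xHom]) _)

end Divisor

end DivisorIdeals

/-! ### Uniqueness of reduced Gröbner bases -/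

section GroebnerUniqueness

variable {σ k : Type*} [Field k] {m : MonomialOrder σ}

open MvPolynomial
open scoped MonomialOrder

theorem span_leadingTerm_image {S : Set (MvPolynomial σ k)}
    (hS : ∀ p ∈ S, m.leadingCoeff p = 1) :
    Ideal.span (m.leadingTerm '' S) =
      Ideal.span ((fun s => monomial s (1 : k)) '' (m.degree '' S)) := by
  rw [Set.image_image]
  congr 1
  refine Set.image_congr fun p hp => ?_
  rw [MonomialOrder.leadingTerm, hS p hp]

theorem monomial_mem_span_leadingTerm_iff {S : Set (MvPolynomial σ k)}
    (hS : ∀ p ∈ S, m.leadingCoeff p = 1) {a : σ →₀ ℕ} {c : k} (hc : c ≠ 0) :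
    monomial a c ∈ Ideal.span (m.leadingTerm '' S) ↔ ∃ p ∈ S, m.degree p ≤ a := by
  classical
  rw [span_leadingTerm_image hS, mem_ideal_span_monomial_image]
  simp [support_monomial, hc]

/-- A criterion for reduced Gröbner bases in terms of divisibility of exponents. -/
theorem isReducedGroebnerBasis_iff {I : Ideal (MvPolynomial σ k)}
    {G : Finset (MvPolynomial σ k)} (hmonic : ∀ p ∈ G, m.leadingCoeff p = 1) :
    IsReducedGroebnerBasis m I G ↔ (∀ p ∈ G, p ∈ I) ∧
      (∀ b ∈ I, b ≠ 0 → ∃ p ∈ G, m.degree p ≤ m.degree b) ∧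
      ∀ p ∈ G, ∀ a ∈ p.support, ∀ q ∈ G, m.degree q ≤ a → q = p := by
  have hsub : ∀ p, ∀ q ∈ (G : Set (MvPolynomial σ k)) \ {p}, m.leadingCoeff q = 1 :=
    fun p q hq => hmonic q hq.1
  constructor
  · rintro ⟨⟨hGI, hspan⟩, -, hred⟩
    refine ⟨hGI, fun b hb hb0 => ?_, fun p hp a ha q hq hqa => ?_⟩
    · have h1 : m.leadingTerm b ∈ Ideal.span (m.leadingTerm '' (G : Set (MvPolynomial σ k))) :=
        hspan ▸ Ideal.subset_span ⟨b, hb, rfl⟩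
      rw [MonomialOrder.leadingTerm, monomial_mem_span_leadingTerm_iff hmonic
        (MonomialOrder.leadingCoeff_ne_zero_iff.2 hb0)] at h1
      exact h1
    · by_contra hqp
      refine hred p hp a ha ?_
      rw [monomial_mem_span_leadingTerm_iff (hsub p) one_ne_zero]
      exact ⟨q, ⟨hq, hqp⟩, hqa⟩
  · rintro ⟨hGI, hdvd, hred⟩
    refine ⟨⟨hGI, le_antisymm (Ideal.span_mono (Set.image_mono hGI)) ?_⟩, hmonic,
      fun p hp a ha hmem => ?_⟩
    · rw [Ideal.span_le]
      rintro _ ⟨b, hb, rfl⟩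
      by_cases hb0 : b = 0
      · rw [hb0, MonomialOrder.leadingTerm_zero]
        exact Ideal.zero_mem _
      · rw [SetLike.mem_coe, MonomialOrder.leadingTerm, monomial_mem_span_leadingTerm_iff hmonic
          (MonomialOrder.leadingCoeff_ne_zero_iff.2 hb0)]
        exact hdvd b hb hb0
    · rw [monomial_mem_span_leadingTerm_iff (hsub p) one_ne_zero] at hmem
      obtain ⟨q, ⟨hq, hqp⟩, hqa⟩ := hmem
      exact hqp (hred p hp a ha q hq hqa)

/-- For `p` in `G` some `p'` in `G'` has the same degree, by dividing leading monomials back and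
forth. If `p ≠ p'`, the monic leading terms cancel, so the leading monomial of `p - p'` is a smaller
monomial of `p` or `p'`. Some basis element has its leading monomial dividing it, and reducedness
forces that element to be `p` or `p'` itself, whose degree is too large. -/
theorem IsReducedGroebnerBasis.subset {I : Ideal (MvPolynomial σ k)}
    {G G' : Finset (MvPolynomial σ k)} (hG : IsReducedGroebnerBasis m I G)
    (hG' : IsReducedGroebnerBasis m I G') : G ⊆ G' := by
  intro p hp
  have hm := hG.monic
  have hm' := hG'.monic
  obtain ⟨hGI, hdvd, hred⟩ := (isReducedGroebnerBasis_iff hm).1 hG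
  obtain ⟨hGI', hdvd', hred'⟩ := (isReducedGroebnerBasis_iff hm').1 hG'
  have ne_zero : ∀ q : MvPolynomial σ k, m.leadingCoeff q = 1 → q ≠ 0 := by
    rintro q hq rfl
    simp at hq
  have hp0 := ne_zero p (hm p hp)
  obtain ⟨p', hp', hle'⟩ := hdvd' p (hGI p hp) hp0
  have hp0' := ne_zero p' (hm' p' hp')
  obtain ⟨q, hq, hle⟩ := hdvd p' (hGI' p' hp') hp0'
  have hqp : q = p := hred p hp _ (m.degree_mem_support hp0) q hq (hle.trans hle')
  have hdeg : m.degree p' = m.degree p := le_antisymm hle' (hqp ▸ hle)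
  suffices p = p' by rwa [this]
  by_contra hne
  have hr0 : p - p' ≠ 0 := sub_ne_zero.2 hne
  have hrI : p - p' ∈ I := I.sub_mem (hGI p hp) (hGI' p' hp')
  have hsupp := m.degree_mem_support hr0
  have hnd : m.degree (p - p') ≠ m.degree p := by
    intro he
    rw [he, mem_support_iff, coeff_sub] at hsupp
    apply hsupp
    have h1 : p.coeff (m.degree p) = 1 := hm p hp
    have h2 : p'.coeff (m.degree p') = 1 := hm' p' hp'
    rw [hdeg] at h2
    rw [h1, h2, sub_self]
  have hlt : m.degree (p - p') ≺[m] m.degree p := by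
    refine lt_of_le_of_ne ?_ fun he => hnd (m.toSyn.injective he)
    have := m.degree_sub_le (f := p) (g := p')
    rwa [hdeg, sup_idem] at this
  have hnle : ¬ m.degree p ≤ m.degree (p - p') := fun h =>
    absurd (m.toSyn_monotone h) (not_le.2 hlt)
  have hor : m.degree (p - p') ∈ p.support ∨ m.degree (p - p') ∈ p'.support := by
    by_contra! hc
    rw [mem_support_iff, coeff_sub, notMem_support_iff.1 hc.1, notMem_support_iff.1 hc.2] at hsupp
    simp at hsupp
  rcases hor with h | h
  · obtain ⟨r, hr, hrle⟩ := hdvd _ hrI hr0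
    have := hred p hp _ h r hr hrle
    exact hnle (this ▸ hrle)
  · obtain ⟨r, hr, hrle⟩ := hdvd' _ hrI hr0
    have := hred' p' hp' _ h r hr hrle
    rw [this, hdeg] at hrle
    exact hnle hrle

end GroebnerUniqueness

/-! ### The explicit reduced basis -/

section ExplicitBasis

variable {k : Type*} [Field k]

open MvPolynomial

theorem leadingCoeff_inX (u : Polynomial k) :
    MonomialOrder.lex.leadingCoeff (inX u) = u.leadingCoeff := by
  by_cases hu : u = 0
  · simp [hu, inX]
  · rw [MonomialOrder.leadingCoeff, degree_inX hu, coeff_inX]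
    simp

theorem leadingCoeff_inX_add_inX_mul_varY (A : Polynomial k) {B : Polynomial k} (hB : B ≠ 0) :
    MonomialOrder.lex.leadingCoeff (inX A + inX B * varY k) = B.leadingCoeff := by
  rw [MonomialOrder.leadingCoeff, degree_inX_add_inX_mul_varY A hB, coeff_add, coeff_inX,
    coeff_inX_mul_varY]
  simp

theorem leadingCoeff_varY_sq_sub_inX (u : Polynomial k) :
    MonomialOrder.lex.leadingCoeff (varY k ^ 2 - inX u) = 1 := by
  rw [MonomialOrder.leadingCoeff, degree_varY_sq_sub_inX, coeff_sub, coeff_inX, coeff_varY_sq]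
  simp

/-- An ideal of `k[x, y]` that is the preimage of `w · (u, y - v)` has a reduced Gröbner basis
that contains `w u` and `w (y - v)`. -/
theorem exists_isReducedGroebnerBasis {F w u v : Polynomial k} (hw : w.Monic) (hu : u.Monic)
    (hu0 : 0 < u.natDegree) (hv : v.degree < u.degree) {I : Ideal (MvPolynomial (Fin 2) k)}
    (hI : ∀ b, b ∈ I ↔ ∃ c d : Polynomial k, cls F b =
      xHom F w * (xHom F c * xHom F u + xHom F d * (yFun F - xHom F v))) :
    ∃ G, IsReducedGroebnerBasis MonomialOrder.lex I G ∧
      inX w * inX u ∈ G ∧ inX w * (varY k - inX v) ∈ G := by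
  classical
  have hwu : (w * u).Monic := hw.mul hu
  have hN : (w * u).natDegree = w.natDegree + u.natDegree := hw.natDegree_mul hu
  have hvn : v.natDegree < u.natDegree := by
    by_cases hv0 : v = 0
    · simpa [hv0] using hu0
    · exact Polynomial.natDegree_lt_natDegree hv0 hv
  have hwv : (w * v).natDegree < (w * u).natDegree :=
    Polynomial.natDegree_mul_le.trans_lt (by omega)
  set p₁ := inX w * inX u with hp₁
  set p₂ := inX w * (varY k - inX v) with hp₂
  -- Reducing `F` modulo `w u` keeps every monomial of the tail below the leading monomial of `p₁`.
  set p₃ := varY k ^ 2 - inX (F %ₘ (w * u)) with hp₃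
  have e₁ : p₁ = inX (w * u) := by simp only [hp₁, inX, map_mul]
  have e₂ : p₂ = inX (-(w * v)) + inX w * varY k := by
    simp only [hp₂, inX, map_mul, map_neg]; ring
  have d₁ : MonomialOrder.lex.degree p₁ = expo 0 (w * u).natDegree := by
    rw [e₁, degree_inX hwu.ne_zero]
  have d₂ : MonomialOrder.lex.degree p₂ = expo 1 w.natDegree := by
    rw [e₂, degree_inX_add_inX_mul_varY _ hw.ne_zero]
  have d₃ : MonomialOrder.lex.degree p₃ = expo 2 0 := degree_varY_sq_sub_inX _
  have m₁ : MonomialOrder.lex.leadingCoeff p₁ = 1 := by rw [e₁, leadingCoeff_inX, hwu]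
  have m₂ : MonomialOrder.lex.leadingCoeff p₂ = 1 := by
    rw [e₂, leadingCoeff_inX_add_inX_mul_varY _ hw.ne_zero, hw]
  have m₃ : MonomialOrder.lex.leadingCoeff p₃ = 1 := leadingCoeff_varY_sq_sub_inX _
  have i₁ : p₁ ∈ I := (hI _).2 ⟨1, 0, by
    rw [hp₁, map_mul, ← xHom_apply, ← xHom_apply]; simp⟩
  have i₂ : p₂ ∈ I := (hI _).2 ⟨0, 1, by
    rw [hp₂, map_mul, map_sub, ← xHom_apply, ← xHom_apply]; simp [yFun]⟩
  have i₃ : p₃ ∈ I := by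
    -- On the curve `y² = F`, so `p₃` becomes `F` minus its remainder, the quotient times `w u`.
    refine (hI _).2 ⟨F /ₘ (w * u), 0, ?_⟩
    have h1 := congrArg (xHom F) (Polynomial.modByMonic_add_div F (w * u))
    have h2 : cls F p₃ = yFun F ^ 2 - xHom F (F %ₘ (w * u)) := by
      rw [hp₃, map_sub, map_pow]; rfl
    rw [h2, yFun_sq, map_zero]
    simp only [map_add, map_mul] at h1
    linear_combination -h1
  have s₁ : ∀ a ∈ p₁.support, a 0 = 0 := by
    intro a ha
    rw [mem_support_iff, e₁, coeff_inX] at ha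
    by_contra h
    simp [h] at ha
  have s₂ : ∀ a ∈ p₂.support, a 0 = 0 ∧ a 1 < (w * u).natDegree ∨
      a 0 = 1 ∧ a 1 ≤ w.natDegree := by
    intro a ha
    rw [mem_support_iff, e₂, coeff_add, coeff_inX, coeff_inX_mul_varY] at ha
    by_cases h0 : a 0 = 0
    · rw [if_pos h0, if_neg (by omega), add_zero, Polynomial.coeff_neg, neg_ne_zero] at ha
      exact Or.inl ⟨h0, (Polynomial.le_natDegree_of_ne_zero ha).trans_lt hwv⟩
    · by_cases h1 : a 0 = 1
      · rw [if_neg h0, if_pos h1, zero_add] at ha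
        exact Or.inr ⟨h1, Polynomial.le_natDegree_of_ne_zero ha⟩
      · simp [h0, h1] at ha
  have s₃ : ∀ a ∈ p₃.support, a 0 = 0 ∧ a 1 < (w * u).natDegree ∨ a 0 = 2 ∧ a 1 = 0 := by
    intro a ha
    rw [mem_support_iff, hp₃, coeff_sub, coeff_inX, coeff_varY_sq] at ha
    by_cases h : a = expo 2 0
    · exact Or.inr (by simp [h])
    · by_cases h0 : a 0 = 0
      · rw [if_neg h, if_pos h0, zero_sub, neg_ne_zero] at ha
        refine Or.inl ⟨h0, (Polynomial.le_natDegree_of_ne_zero ha).trans_lt ?_⟩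
        refine Polynomial.natDegree_modByMonic_lt F hwu fun h1 => ?_
        rw [h1, Polynomial.natDegree_one] at hN
        omega
      · simp [h, h0] at ha
  have hlead : ∀ b ∈ I, b ≠ 0 → 2 ≤ MonomialOrder.lex.degree b 0 ∨
      MonomialOrder.lex.degree p₁ ≤ MonomialOrder.lex.degree b ∨
      MonomialOrder.lex.degree p₂ ≤ MonomialOrder.lex.degree b := by
    intro b hb hb0
    obtain ⟨q, A, B, rfl⟩ := exists_normal_form F b
    by_cases hq : q = 0
    · subst hq
      obtain ⟨c, d, hcd⟩ := (hI _).1 hb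
      simp only [zero_mul, zero_add] at hb0 hcd ⊢
      -- Comparing coefficients of `1` and `y` in `w (c u + d (y - v))`.
      have h1 := xHom_add_inj (F := F) (A := A) (B := B) (A' := w * (c * u - d * v))
        (B' := w * d) (by
          rw [map_add, map_mul] at hcd
          change xHom F A + xHom F B * yFun F = _ at hcd
          simp only [map_mul, map_sub]
          linear_combination hcd)
      obtain ⟨rfl, rfl⟩ := h1
      right
      by_cases hd : d = 0
      · left
        subst hd
        have hc : c ≠ 0 := by
          rintro rfl
          simp [inX] at hb0
        have h2 : inX (w * (c * u - 0 * v)) + inX (w * 0) * varY k = inX ((w * u) * c) := by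
          simp only [inX, map_mul, map_sub, map_zero]; ring
        rw [h2, degree_inX (mul_ne_zero hwu.ne_zero hc), d₁, expo_le_iff,
          hwu.natDegree_mul' hc]
        simp
      · right
        rw [degree_inX_add_inX_mul_varY _ (mul_ne_zero hw.ne_zero hd), d₂, expo_le_iff,
          hw.natDegree_mul' hd]
        simp
    · exact Or.inl (two_le_degree_mul_equation_add F A B hq)
  clear_value p₁ p₂ p₃
  -- For `w = 1` the leading monomial of `p₂` is `y`, which divides `y²`, so `p₃` is redundant. For
  -- `deg w > 0` the monomial `y x^(deg w)` does not divide `y²`, and `p₃` is needed.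
  by_cases hw1 : w = 1
  · have hn : w.natDegree = 0 := by rw [hw1, Polynomial.natDegree_one]
    refine ⟨{p₁, p₂}, (isReducedGroebnerBasis_iff ?_).2 ⟨?_, ?_, ?_⟩, by simp, by simp⟩
    · simp [m₁, m₂]
    · simp [i₁, i₂]
    · intro b hb hb0
      rcases hlead b hb hb0 with h | h | h
      · exact ⟨p₂, by simp, by rw [d₂, expo_le_iff]; omega⟩
      · exact ⟨p₁, by simp, h⟩
      · exact ⟨p₂, by simp, h⟩
    · simp only [Finset.mem_insert, Finset.mem_singleton]
      rintro p (rfl | rfl) a ha q (rfl | rfl) hle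
      · rfl
      · have := s₁ a ha
        rw [d₂, expo_le_iff] at hle
        omega
      · have := s₂ a ha
        rw [d₁, expo_le_iff] at hle
        omega
      · rfl
  · have hn : 0 < w.natDegree := Nat.pos_of_ne_zero fun h0 =>
      hw1 (Polynomial.eq_one_of_monic_natDegree_zero hw h0)
    refine ⟨{p₁, p₂, p₃}, (isReducedGroebnerBasis_iff ?_).2 ⟨?_, ?_, ?_⟩, by simp, by simp⟩
    · simp [m₁, m₂, m₃]
    · simp [i₁, i₂, i₃]
    · intro b hb hb0
      rcases hlead b hb hb0 with h | h | h
      · exact ⟨p₃, by simp, by rw [d₃, expo_le_iff]; omega⟩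
      · exact ⟨p₁, by simp, h⟩
      · exact ⟨p₂, by simp, h⟩
    · simp only [Finset.mem_insert, Finset.mem_singleton]
      rintro p (rfl | rfl | rfl) a ha q (rfl | rfl | rfl) hle
      · rfl
      · have := s₁ a ha
        rw [d₂, expo_le_iff] at hle
        omega
      · have := s₁ a ha
        rw [d₃, expo_le_iff] at hle
        omega
      · have := s₂ a ha
        rw [d₁, expo_le_iff] at hle
        omega
      · rfl
      · have := s₂ a ha
        rw [d₃, expo_le_iff] at hle
        omega
      · have := s₃ a ha
        rw [d₁, expo_le_iff] at hle
        omega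
      · have := s₃ a ha
        rw [d₂, expo_le_iff] at hle
        omega
      · rfl

end ExplicitBasis

/-! ### The Mumford polynomial `u` is monic and non-constant -/

section MumfordPolynomial

variable {k : Type*} [Field k] {F : Polynomial k}

open Polynomial

theorem Divisor.xPoly_monic (D : Divisor F) : D.xPoly.Monic := by
  refine monic_prod_of_monic _ _ ?_
  rintro (_ | P) _
  · exact monic_one
  · exact (monic_X_sub_C P.x).pow _

/-- Positivity of `deg u₃` is where `d₃ ≠ 0` matters: for `u₃ = 1` the element `u_o u₃` would have a
leading monomial dividing that of `u_o (y - v₃)`, and the latter would leave the reduced basis. -/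
theorem Divisor.IsSemiReduced.natDegree_xPoly_pos {D : Divisor F} (hD : D.IsSemiReduced)
    (hne : D ≠ 0) : 0 < D.xPoly.natDegree := by
  obtain ⟨P, hP⟩ := Finsupp.support_nonempty_iff.2 hne
  rcases P with _ | P
  · exact absurd hD.affine (Finsupp.mem_support_iff.1 hP)
  · have hpos : 0 < D (some P) :=
      lt_of_le_of_ne (hD.effective _) (Finsupp.mem_support_iff.1 hP).symm
    have h1 := natDegree_le_of_dvd (D.pow_dvd_xPoly hP) D.xPoly_monic.ne_zero
    rw [natDegree_pow, natDegree_X_sub_C] at h1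
    omega

end MumfordPolynomial

end

end HyperellipticCurve

open HyperellipticCurve in
theorem mainTheorem3 {K Kbar : Type*} [Field K] [Field Kbar] [Algebra K Kbar]
    [IsAlgClosure K Kbar] (hchar : ringChar K ≠ 2)
    (g : ℕ) (f : Polynomial K) (hmonic : f.Monic) (hdeg : f.natDegree = 2 * g + 1)
    (hroots : (f.aroots Kbar).Nodup)
    (d₁ d₂ d₃ dbar : Divisor (f.map (algebraMap K Kbar)))
    (h₁ : d₁.IsSemiReduced) (h₂ : d₂.IsSemiReduced) (h₃ : d₃.IsSemiReduced) (h₃ne : d₃ ≠ 0)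
    (hbar : dbar.IsEffective)
    (hsum : d₁ + d₂ = d₃ + dbar + dbar.iotaPullback)
    (u₃ v₃ uo : Polynomial Kbar) (hM : d₃.IsMumfordRep u₃ v₃) (huo : uo.Monic)
    (hdiv : HasDivisor g (inX uo)
      (dbar + dbar.iotaPullback -
        Finsupp.single (infinity (f.map (algebraMap K Kbar))) (2 * dbar.deg))) :
    (∃! G : Finset (MvPolynomial (Fin 2) Kbar),
        IsReducedGroebnerBasis MonomialOrder.lex (d₁ + d₂).polyIdeal G) ∧
      ∀ G : Finset (MvPolynomial (Fin 2) Kbar),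
        IsReducedGroebnerBasis MonomialOrder.lex (d₁ + d₂).polyIdeal G →
          inX uo * inX u₃ ∈ G ∧ inX uo * (varY Kbar - inX v₃) ∈ G := by
  have : IsAlgClosed Kbar := IsAlgClosure.isAlgClosed K
  have two : (2 : Kbar) ≠ 0 := by
    have h := (algebraMap K Kbar).injective.ne (Ring.two_ne_zero hchar)
    rwa [map_ofNat, map_zero] at h
  have hF : f.map (algebraMap K Kbar) ≠ 0 := (hmonic.map _).ne_zero
  -- The ideal is `u_o · (u₃, y - v₃)`: the conjugate pairs contribute `u_o`, the semi-reduced part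
  -- its Mumford generators.
  have hI : ∀ b, b ∈ (d₁ + d₂).polyIdeal ↔ ∃ c d : Polynomial Kbar,
      cls (f.map (algebraMap K Kbar)) b = xHom _ uo *
        (xHom _ c * xHom _ u₃ + xHom _ d * (yFun _ - xHom _ v₃)) := by
    intro b
    rw [hsum, Divisor.polyIdeal, Ideal.mem_comap,
      Divisor.mem_ideal_add_iff two hF hroots huo hbar h₃.effective hdiv]
    constructor
    · rintro ⟨h, hh, e⟩
      obtain ⟨c, d, rfl⟩ := (hM.mem_ideal_iff two h₃ h).1 hh
      exact ⟨c, d, e⟩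
    · rintro ⟨c, d, e⟩
      exact ⟨_, (hM.mem_ideal_iff two h₃ _).2 ⟨c, d, rfl⟩, e⟩
  obtain ⟨G, hG, hG₁, hG₂⟩ := exists_isReducedGroebnerBasis huo (hM.u_eq ▸ d₃.xPoly_monic)
    (hM.u_eq ▸ h₃.natDegree_xPoly_pos h₃ne) hM.degree_lt hI
  exact ⟨⟨G, hG, fun G' hG' => (hG'.subset hG).antisymm (hG.subset hG')⟩,
    fun G' hG' => ⟨hG.subset hG' hG₁, hG.subset hG' hG₂⟩⟩
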